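/- Let $\nu,\mu$ be mutually absolutely continuous probability measures on $\mathbb R$ whose log-likelihood ratio $\ell=\log\frac{d\mu}{d\nu}$ is integrable under both, and let $I_1=\int \ell\,d\mu$ and $I_0=-\int \ell\,d\nu$ satisfy $0<I_0,I_1<\infty$. Put $I=\min\{I_0,I_1\}$. There are $s$ sensors $i=1,\dots,s$; there is no attack, and under hypothesis $\theta\in\{0,1\}$ all observations $x_i(k)$ ($1\le i\le s$, $k\ge1$) are independent, with law $\nu$ if $\theta=0$ and $\mu$ if $\theta=1$; write $\mathbb P_\theta,\mathbb E_\theta$ for the resulting probability and expectation. A test is a sequence $f=(f_k)_{k\ge1}$ of measurable maps from the observations at times $1,\dots,k$ to $\{\text{continue},0,1\}$; it stops at the first time $T\in\{1,2,\dots\}\cup\{\infty\}$ at which $f_T\ne\text{continue}$. Let $\alpha=\mathbb P_0[T<\infty,\,f_T=1]$, $\beta=\mathbb P_1[T<\infty,\,f_T=0]$ and $D(T)=\max_{\theta}\mathbb E_\theta[T]\in[1,\infty]$. The performance of a family of tests is $\gamma=\lim_{\alpha=\beta\to0^+}\frac{\log(1/\alpha)}{D(T)}$, where the quotient is $0$ if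 $D(T)=\infty$. For a set $\mathcal M\subseteq\{1,\dots,s\}$ and thresholds $a,b>0$, the sum-SPRT $f_{\mathcal M}$ stops and chooses $0$ when $S_{\mathcal M}(k)\le -a$, stops and chooses $1$ when $S_{\mathcal M}(k)\ge b$, and continues otherwise, where $S_{\mathcal M}(k)=\sum_{i\in\mathcal M}\sum_{j=1}^{k}\ell(x_i(j))$. It is regarded as a family of tests indexed by $(a,b)$. (1) For every family of tests that use only the observations of the sensors in $\mathcal M$, the upper limit of $\log(1/\alpha)/D(T)$ as $\alpha=\beta\to0^+$ is at most $|\mathcal M|\,I$. (2) The tests $f_{\mathcal M}$ use only the observations of the sensors in $\mathcal M$, and if $\mathcal M\neq\emptyset$, then $\log(1/\alpha)/D(T)\to|\mathcal M|\,I$ for the family $f_{\mathcal M}$ as $\alpha=\beta\to0^+$. (3) Both (1) and the limit in (2) also hold when the regime $\alpha=\beta\to0^+$ is relaxed to $\alpha\to0^+$, $\beta\to0^+$, $\log\alpha/\log\beta\to1$; and, if $\mathcal M\ne\emptyset$, the thresholds $(a,b)$ of $f_{\mathcal M}$ can be chosen so as to realise this relaxed regime. -/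

import Mathlib

open MeasureTheory Filter Topology
open scoped ENNReal

noncomputable section

namespace SeqDetect

/-- The three possible outputs of a detector: take another observation, or stop and choose the
hypothesis `H₀` (`zero`) or `H₁` (`one`). -/
inductive Decision : Type
  | cont : Decision
  | zero : Decision
  | one : Decision

instance : MeasurableSpace Decision := ⊤

/-- A realisation of all observations of `s` sensors. Time is indexed from `0`: `ω k i` is the
observation of sensor `i` at time `k + 1`. -/
abbrev Path (s : ℕ) : Type := ℕ → Fin s → ℝ

/-- The observations at times `1, …, k + 1`. -/
def history {s : ℕ} (k : ℕ) (ω : Path s) : Fin (k + 1) → Fin s → ℝ := fun j => ω j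

/-- The law of all observations when there is no attack and each single observation has law `ρ`:
all observations, from different sensors and at different times, are independent with law `ρ`. -/
def pathLaw (s : ℕ) (ρ : Measure ℝ) [IsProbabilityMeasure ρ] : Measure (Path s) :=
  Measure.infinitePi (fun _ : ℕ => Measure.pi (fun _ : Fin s => ρ))

/-- A detection strategy: for each time `k + 1`, a measurable map from the observations at times
`1, …, k + 1` to the set of decisions. -/
structure Strategy (s : ℕ) : Type where
  detect : (k : ℕ) → (Fin (k + 1) → Fin s → ℝ) → Decision
  measurable_detect : ∀ k, Measurable (detect k)

namespace Strategy

variable {s : ℕ}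

/-- The strategy uses only the observations of the sensors in `M`. -/
def BasedOn (f : Strategy s) (M : Finset (Fin s)) : Prop :=
  ∀ (k : ℕ) (x y : Fin (k + 1) → Fin s → ℝ),
    (∀ j, ∀ i ∈ M, x j i = y j i) → f.detect k x = f.detect k y

/-- The time at which the test terminates (`⊤` if it never does). -/
def stopTime (f : Strategy s) (ω : Path s) : ℕ∞ :=
  ⨅ (k : ℕ) (_ : f.detect k (history k ω) ≠ Decision.cont), ((k + 1 : ℕ) : ℕ∞)

/-- The event that the test terminates with decision `d`. -/
def decides (f : Strategy s) (d : Decision) : Set (Path s) :=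
  {ω | ∃ k, f.detect k (history k ω) = d ∧
    ∀ j < k, f.detect j (history j ω) = Decision.cont}

/-- Type-I error probability; `ν` is the law of an observation under `H₀`. -/
def errorI (ν : Measure ℝ) [IsProbabilityMeasure ν] (f : Strategy s) : ℝ :=
  (pathLaw s ν).real (f.decides Decision.one)

/-- Type-II error probability; `μ` is the law of an observation under `H₁`. -/
def errorII (μ : Measure ℝ) [IsProbabilityMeasure μ] (f : Strategy s) : ℝ :=
  (pathLaw s μ).real (f.decides Decision.zero)

/-- The worst-case average sample number. -/
def delay (ν μ : Measure ℝ) [IsProbabilityMeasure ν] [IsProbabilityMeasure μ]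
    (f : Strategy s) : ℝ≥0∞ :=
  max (∫⁻ ω, (f.stopTime ω : ℝ≥0∞) ∂(pathLaw s ν)) (∫⁻ ω, (f.stopTime ω : ℝ≥0∞) ∂(pathLaw s μ))

/-- The ratio `log (1 / α) / D(T)`, equal to `0` when the delay is infinite and `0 < α`.
The delay is at least `1`. -/
def efficiency (ν μ : Measure ℝ) [IsProbabilityMeasure ν] [IsProbabilityMeasure μ]
    (f : Strategy s) : ℝ≥0∞ :=
  ENNReal.ofReal (Real.log (1 / f.errorI ν)) / f.delay ν μ

end Strategy

/-- For a family of strategies, the limiting regime `α = β → 0⁺`. -/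
def equalErrors {s : ℕ} {ι : Type*} (ν μ : Measure ℝ) [IsProbabilityMeasure ν]
    [IsProbabilityMeasure μ] (f : ι → Strategy s) : Filter ι :=
  comap (fun i => (f i).errorI ν) (𝓝[>] 0) ⊓ 𝓟 {i | (f i).errorI ν = (f i).errorII μ}

/-- For a family of strategies, the limiting regime `α → 0⁺`, `β → 0⁺` with
`log α / log β → 1`. It contains the regime `α = β → 0⁺`, and is also meaningful for families that
cannot realise `α = β` exactly, as happens when likelihood ratios are discrete. -/
def balancedErrors {s : ℕ} {ι : Type*} (ν μ : Measure ℝ) [IsProbabilityMeasure ν]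
    [IsProbabilityMeasure μ] (f : ι → Strategy s) : Filter ι :=
  comap (fun i => (f i).errorI ν) (𝓝[>] 0) ⊓ comap (fun i => (f i).errorII μ) (𝓝[>] 0) ⊓
    comap (fun i => Real.log ((f i).errorI ν) / Real.log ((f i).errorII μ)) (𝓝 1)

/-- The cumulative log-likelihood ratio `∑ i ∈ M, ∑ j, log (dμ/dν) (x j i)`. -/
def cumLLR {s : ℕ} (ν μ : Measure ℝ) (M : Finset (Fin s)) (k : ℕ)
    (x : Fin (k + 1) → Fin s → ℝ) : ℝ :=
  ∑ i ∈ M, ∑ j, llr μ ν (x j i)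

theorem measurable_cumLLR {s : ℕ} (ν μ : Measure ℝ) (M : Finset (Fin s)) (k : ℕ) :
    Measurable (cumLLR ν μ M k) := by
  unfold cumLLR
  refine Finset.measurable_sum _ fun i _ => Finset.measurable_sum _ fun j _ => ?_
  exact (measurable_llr μ ν).comp ((measurable_pi_apply i).comp (measurable_pi_apply j))

/-- Pairs `(a, b)` of positive thresholds. -/
abbrev Thresholds : Type := {p : ℝ × ℝ // 0 < p.1 ∧ 0 < p.2}

open Classical in
/-- The sum-SPRT on the sensors in `M` with thresholds `-a < 0 < b`. -/
def sumSPRT {s : ℕ} (ν μ : Measure ℝ) (M : Finset (Fin s)) (p : Thresholds) : Strategy s where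
  detect k x :=
    if cumLLR ν μ M k x ≤ -p.1.1 then Decision.zero
    else if p.1.2 ≤ cumLLR ν μ M k x then Decision.one
    else Decision.cont
  measurable_detect k :=
    Measurable.ite (measurableSet_le (measurable_cumLLR ν μ M k) measurable_const)
      measurable_const
      (Measurable.ite (measurableSet_le measurable_const (measurable_cumLLR ν μ M k))
        measurable_const measurable_const)

/-- The Kullback-Leibler number `I₁`. -/
def klOne (ν μ : Measure ℝ) : ℝ := ∫ x, llr μ ν x ∂μ

/-- The Kullback-Leibler number `I₀`. -/
def klZero (ν μ : Measure ℝ) : ℝ := -∫ x, llr μ ν x ∂ν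

end SeqDetect

end

/-! Under H₁ the log-likelihood walk `S` has drift `|M| I₁`, and `exp (-S)` is the density of the
H₀-law with respect to the H₁-law on events determined by the past of the sensors in `M`. Everything
follows from this and from Wald's identity for the test truncated at time `n`; H₀ is the same
situation with `-S` and the two decisions exchanged.

Converse: on the event of deciding 1, `1 + x ≤ exp x` at `x = g - S` bounds the mean of `S` from
below. With Wald's identity and `g = log (1/α)` this gives `(1 - β) log (1/α) ≤ |M| I₁ E₁[T] + 1`
(`mul_log_le_delay`). With its mirror image, dividing by `log (1/α)` yields the upper bound
(`exists_efficiency_le_tendsto`).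

Achievability: if the steps are cut off from above at `c`, the overshoot over `b` is at most `c`, so
`E₁[T] ≤ (b + c) / m_c` with `m_c` the truncated drift (`tsum_le_of_lt`). The density gives `α ≤ exp
(-b)`, hence `b ≤ log (1/α)`. Letting the errors vanish for fixed `c`, with `m_c` close to the true
drift, gives the lower bound; integrability of `ℓ` suffices.

The relaxed regime is realised by `a = b = n + 1`: the two delay bounds together force `log (1/α)`
and `log (1/β)` to be asymptotic to `n + 1` (`tendsto_log_div`). -/

noncomputable section

/-! ### Wald's identity and its consequences for abstract sequential tests. -/

namespace SeqDetect

/-- The combinatorial data of a sequential test: `C k` is the event that the test is still running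
after `k` observations, and it splits into `C (k + 1)` and the events `A k`, `B k` that the test
stops with one or the other decision at the next observation. -/
structure IsTestTree {Ω : Type*} {mΩ : MeasurableSpace Ω} (ℱ : Filtration ℕ mΩ)
    (C A B : ℕ → Set Ω) : Prop where
  zero : C 0 = Set.univ
  measC : ∀ k, MeasurableSet[ℱ k] (C k)
  measA : ∀ k, MeasurableSet[ℱ (k + 1)] (A k)
  measB : ∀ k, MeasurableSet[ℱ (k + 1)] (B k)
  split : ∀ k, C k = C (k + 1) ∪ (A k ∪ B k)
  disjC : ∀ k, Disjoint (C (k + 1)) (A k ∪ B k)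
  disjAB : ∀ k, Disjoint (A k) (B k)

namespace IsTestTree

variable {Ω : Type*} {mΩ : MeasurableSpace Ω} {ℱ : Filtration ℕ mΩ} {C A B : ℕ → Set Ω}
  {P Q : Measure Ω} {X : ℕ → Ω → ℝ}

theorem swap (h : IsTestTree ℱ C A B) : IsTestTree ℱ C B A where
  zero := h.zero
  measC := h.measC
  measA := h.measB
  measB := h.measA
  split k := by rw [Set.union_comm (B k)]; exact h.split k
  disjC k := by rw [Set.union_comm (B k)]; exact h.disjC k
  disjAB k := (h.disjAB k).symm

theorem measurableSet_C (h : IsTestTree ℱ C A B) (k : ℕ) : MeasurableSet (C k) :=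
  ℱ.le k _ (h.measC k)

theorem measurableSet_A (h : IsTestTree ℱ C A B) (k : ℕ) : MeasurableSet (A k) :=
  ℱ.le _ _ (h.measA k)

theorem measurableSet_B (h : IsTestTree ℱ C A B) (k : ℕ) : MeasurableSet (B k) :=
  ℱ.le _ _ (h.measB k)

theorem antitone (h : IsTestTree ℱ C A B) : Antitone C :=
  antitone_nat_of_succ_le fun k => by rw [h.split k]; exact Set.subset_union_left

theorem A_subset (h : IsTestTree ℱ C A B) (k : ℕ) : A k ⊆ C k := by
  rw [h.split k]; exact fun x hx => Or.inr (Or.inl hx)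

theorem pairwise_disjoint (h : IsTestTree ℱ C A B) : Pairwise (Function.onFun Disjoint A) := by
  have key : ∀ i j, i < j → Disjoint (A i) (A j) := fun i j hij =>
    ((h.disjC i).symm.mono_left Set.subset_union_left).mono_right
      ((h.A_subset j).trans (h.antitone hij))
  intro i j hij
  rcases lt_or_gt_of_ne hij with hlt | hlt
  · exact key i j hlt
  · exact (key j i hlt).symm

theorem setIntegral_split (h : IsTestTree ℱ C A B) (k : ℕ) {f : Ω → ℝ} (hf : Integrable f P) :
    ∫ ω in C k, f ω ∂P = ∫ ω in C (k + 1), f ω ∂P + (∫ ω in A k, f ω ∂P + ∫ ω in B k, f ω ∂P) := by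
  rw [h.split k, setIntegral_union (h.disjC k)
    ((h.measurableSet_A k).union (h.measurableSet_B k)) hf.integrableOn hf.integrableOn,
    setIntegral_union (h.disjAB k) (h.measurableSet_B k) hf.integrableOn hf.integrableOn]

theorem real_split [IsFiniteMeasure P] (h : IsTestTree ℱ C A B) (k : ℕ) :
    P.real (C k) = P.real (C (k + 1)) + (P.real (A k) + P.real (B k)) := by
  simpa using h.setIntegral_split (P := P) k (integrable_const (1 : ℝ))

theorem sum_real_add_real [IsProbabilityMeasure P] (h : IsTestTree ℱ C A B) (n : ℕ) :
    ∑ k ∈ Finset.range n, (P.real (A k) + P.real (B k)) + P.real (C n) = 1 := by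
  induction n with
  | zero => simp [h.zero]
  | succ n ih => rw [Finset.sum_range_succ]; linarith [h.real_split (P := P) n]

theorem sum_real_le [IsFiniteMeasure P] (h : IsTestTree ℱ C A B) (n : ℕ) :
    ∑ k ∈ Finset.range n, P.real (A k) ≤ P.real (⋃ k, A k) := by
  rw [← measureReal_biUnion_finset (fun i _ j _ hij => h.pairwise_disjoint hij)
    (fun k _ => h.measurableSet_A k)]
  exact measureReal_mono (Set.iUnion₂_subset fun k _ => Set.subset_iUnion A k)

/-- Wald's identity for a test truncated at time `n`. -/
theorem wald [IsFiniteMeasure P] (h : IsTestTree ℱ C A B) {m : ℝ}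
    (hX : ∀ k, Integrable (X k) P) (hm : ∀ k, ∫ ω in C k, X k ω ∂P = P.real (C k) * m) (n : ℕ) :
    ∑ k ∈ Finset.range n, (∫ ω in A k, ∑ j ∈ Finset.range (k + 1), X j ω ∂P
      + ∫ ω in B k, ∑ j ∈ Finset.range (k + 1), X j ω ∂P)
      + ∫ ω in C n, ∑ j ∈ Finset.range n, X j ω ∂P = m * ∑ k ∈ Finset.range n, P.real (C k) := by
  have hS : ∀ n, Integrable (fun ω => ∑ j ∈ Finset.range n, X j ω) P :=
    fun n => integrable_finsetSum _ fun j _ => hX j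
  induction n with
  | zero => simp
  | succ n ih =>
    have h1 := h.setIntegral_split n (hS (n + 1))
    have h2 : ∫ ω in C n, ∑ j ∈ Finset.range (n + 1), X j ω ∂P
        = ∫ ω in C n, ∑ j ∈ Finset.range n, X j ω ∂P + P.real (C n) * m := by
      rw [← hm n, ← integral_add (hS n).integrableOn (hX n).integrableOn]
      simp_rw [Finset.sum_range_succ]
    rw [Finset.sum_range_succ, Finset.sum_range_succ, mul_add, ← ih]
    linarith

/-- The exponential of minus `S` is a density of `Q` with respect to `P` on `A`; in particular
`S` cannot be much smaller than `log (P A / Q A)` on average. -/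
theorem real_mul_sub_setIntegral_le [IsFiniteMeasure P] [IsFiniteMeasure Q] {S : Ω → ℝ} {E : Set Ω}
    (hS : Integrable S P)
    (hPQ : ∫⁻ ω in E, ENNReal.ofReal (Real.exp (-S ω)) ∂P = Q E) (g : ℝ) :
    P.real E * g - ∫ ω in E, S ω ∂P ≤ Real.exp g * Q.real E - P.real E := by
  have hnn : 0 ≤ᵐ[P.restrict E] fun ω => Real.exp (-S ω) := ae_of_all _ fun ω => (Real.exp_pos _).le
  have hme : AEStronglyMeasurable (fun ω => Real.exp (-S ω)) (P.restrict E) :=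
    (Real.continuous_exp.comp_aestronglyMeasurable hS.1.neg).restrict
  have hint : IntegrableOn (fun ω => Real.exp (-S ω)) E P := by
    refine ⟨hme, ?_⟩
    rw [hasFiniteIntegral_iff_ofReal hnn, hPQ]
    exact measure_lt_top _ _
  have hval : ∫ ω in E, Real.exp (-S ω) ∂P = Q.real E := by
    rw [integral_eq_lintegral_of_nonneg_ae hnn hme, hPQ, Measure.real]
  calc P.real E * g - ∫ ω in E, S ω ∂P = ∫ ω in E, (g - S ω) ∂P := by
        rw [integral_sub (integrable_const _) hS.integrableOn]; simp
    _ ≤ ∫ ω in E, (Real.exp g * Real.exp (-S ω) - 1) ∂P := by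
        refine integral_mono ((integrable_const _).sub hS.integrableOn)
          ((hint.const_mul _).sub (integrable_const _)) fun ω => ?_
        simp only
        rw [← Real.exp_add]
        -- The pointwise inequality `1 + x ≤ exp x` takes the place of Jensen's inequality, so no
        -- case `P E = 0` or `Q E = 0` has to be set apart.
        linarith [Real.add_one_le_exp (g + -S ω)]
    _ = Real.exp g * Q.real E - P.real E := by
        rw [integral_sub (hint.const_mul _) (integrable_const _), integral_const_mul, hval]
        simp

/-- The previous bound is used with level `g` on the `A k` and level `0` on the `B k` and on `C n`.
These events partition the space, so the masses that do not carry `exp g` contribute `-1` under `P`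
and at most `1` under `Q`, and they cancel. -/
theorem sum_real_mul_le [IsProbabilityMeasure P] [IsProbabilityMeasure Q]
    (h : IsTestTree ℱ C A B) {m : ℝ}
    (hX : ∀ k, Integrable (X k) P) (hm : ∀ k, ∫ ω in C k, X k ω ∂P = P.real (C k) * m)
    (hPQ : ∀ k E, MeasurableSet[ℱ k] E →
      ∫⁻ ω in E, ENNReal.ofReal (Real.exp (-∑ j ∈ Finset.range k, X j ω)) ∂P = Q E)
    (g : ℝ) (n : ℕ) :
    (∑ k ∈ Finset.range n, P.real (A k)) * g
      ≤ m * ∑ k ∈ Finset.range n, P.real (C k) + Real.exp g * Q.real (⋃ k, A k) := by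
  have hS : ∀ n, Integrable (fun ω => ∑ j ∈ Finset.range n, X j ω) P :=
    fun n => integrable_finsetSum _ fun j _ => hX j
  have hA := Finset.sum_le_sum fun k (_ : k ∈ Finset.range n) =>
    real_mul_sub_setIntegral_le (hS (k + 1)) (hPQ _ _ (h.measA k)) g
  have hB := Finset.sum_le_sum fun k (_ : k ∈ Finset.range n) =>
    real_mul_sub_setIntegral_le (hS (k + 1)) (hPQ _ _ (h.measB k)) 0
  have hC := real_mul_sub_setIntegral_le (hS n) (hPQ _ _ (h.measC n)) 0
  have hw := h.wald hX hm n
  have h1 := h.sum_real_add_real (P := P) n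
  have h2 := h.sum_real_add_real (P := Q) n
  have h3 : 0 ≤ ∑ k ∈ Finset.range n, Q.real (A k) := Finset.sum_nonneg fun _ _ => measureReal_nonneg
  have h4 := mul_le_mul_of_nonneg_left (h.sum_real_le (P := Q) n) (Real.exp_pos g).le
  simp only [Finset.sum_sub_distrib, Finset.sum_add_distrib, ← Finset.sum_mul, ← Finset.mul_sum,
    Real.exp_zero, mul_zero, one_mul, Finset.sum_const_zero] at hA hB hC hw h1 h2
  linarith

theorem sum_real_C_le [IsProbabilityMeasure P] {D : ℝ≥0∞} (hD : ∑' k, P (C k) ≤ D) (hD' : D ≠ ∞)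
    (n : ℕ) : ∑ k ∈ Finset.range n, P.real (C k) ≤ D.toReal := by
  have h1 : ∑ k ∈ Finset.range n, P (C k) ≤ D := (ENNReal.sum_le_tsum _).trans hD
  have := ENNReal.toReal_mono hD' h1
  rwa [ENNReal.toReal_sum fun _ _ => measure_ne_top _ _] at this

theorem tendsto_real_C [IsProbabilityMeasure P] {D : ℝ≥0∞} (hD : ∑' k, P (C k) ≤ D) (hD' : D ≠ ∞) :
    Tendsto (fun n => P.real (C n)) atTop (𝓝 0) := by
  have h1 := ENNReal.tendsto_atTop_zero_of_tsum_ne_top (ne_top_of_le_ne_top hD' hD)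
  exact (ENNReal.tendsto_toReal ENNReal.zero_ne_top).comp h1

/-- Wald's lower bound for the average sample number. -/
theorem mul_le_mul_delay_add [IsProbabilityMeasure P] [IsProbabilityMeasure Q]
    (h : IsTestTree ℱ C A B) {m : ℝ} (hm0 : 0 ≤ m)
    (hX : ∀ k, Integrable (X k) P) (hm : ∀ k, ∫ ω in C k, X k ω ∂P = P.real (C k) * m)
    (hPQ : ∀ k E, MeasurableSet[ℱ k] E →
      ∫⁻ ω in E, ENNReal.ofReal (Real.exp (-∑ j ∈ Finset.range k, X j ω)) ∂P = Q E)
    {D : ℝ≥0∞} (hD : ∑' k, P (C k) ≤ D) (hD' : D ≠ ∞) {g : ℝ} (hg : 0 ≤ g) :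
    (1 - P.real (⋃ k, B k)) * g ≤ m * D.toReal + Real.exp g * Q.real (⋃ k, A k) := by
  have hlim : Tendsto (fun n => (1 - P.real (⋃ k, B k) - P.real (C n)) * g) atTop
      (𝓝 ((1 - P.real (⋃ k, B k) - 0) * g)) :=
    ((tendsto_const_nhds.sub (tendsto_real_C hD hD')).mul_const g)
  rw [sub_zero] at hlim
  refine le_of_tendsto' hlim fun n => ?_
  have h1 := h.sum_real_add_real (P := P) n
  rw [Finset.sum_add_distrib] at h1
  have h2 := h.swap.sum_real_le (P := P) n
  have h3 := h.sum_real_mul_le hX hm hPQ g n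
  have h4 := mul_le_mul_of_nonneg_left (sum_real_C_le hD hD' n) hm0
  have h5 := mul_le_mul_of_nonneg_right
    (show 1 - P.real (⋃ k, B k) - P.real (C n) ≤ ∑ k ∈ Finset.range n, P.real (A k) by linarith) hg
  linarith

/-- An upper bound for the average sample number of a test that stops as soon as the random walk
reaches the level `b`, through the walk with steps truncated from above at `c`. -/
theorem tsum_le_of_lt [IsProbabilityMeasure P] (h : IsTestTree ℱ C A B) {m b c : ℝ} (hc : 0 ≤ c)
    (hm0 : 0 < m) (hX : ∀ k, Integrable (fun ω => min (X k ω) c) P)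
    (hm : ∀ k, ∫ ω in C k, min (X k ω) c ∂P = P.real (C k) * m)
    (hb : ∀ k, ∀ ω ∈ C k, ∑ j ∈ Finset.range k, X j ω ≤ b) :
    ∑' k, P (C k) ≤ ENNReal.ofReal ((b + c) / m) := by
  have hS : ∀ n, Integrable (fun ω => ∑ j ∈ Finset.range n, min (X j ω) c) P :=
    fun n => integrable_finsetSum _ fun j _ => hX j
  have hCb : ∀ k, ∀ ω ∈ C k, ∑ j ∈ Finset.range k, min (X j ω) c ≤ b := fun k ω hω =>
    (Finset.sum_le_sum fun j _ => min_le_left _ _).trans (hb k ω hω)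
  -- Before the last step the walk is at most `b`, and a truncated step adds at most `c`: this
  -- controls the overshoot without a second moment.
  have hstep : ∀ k, ∀ ω ∈ C k, ∑ j ∈ Finset.range (k + 1), min (X j ω) c ≤ b + c := by
    intro k ω hω
    rw [Finset.sum_range_succ]
    exact add_le_add (hCb k ω hω) (min_le_right _ _)
  have hbound : ∀ {E : Set Ω} {n : ℕ}, MeasurableSet E →
      (∀ ω ∈ E, ∑ j ∈ Finset.range n, min (X j ω) c ≤ b + c) →
      ∫ ω in E, ∑ j ∈ Finset.range n, min (X j ω) c ∂P ≤ P.real E * (b + c) := by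
    intro E n hE hle
    calc _ ≤ ∫ _ in E, (b + c) ∂P :=
          setIntegral_mono_on (hS n).integrableOn (integrable_const _) hE hle
      _ = _ := by simp
  refine ENNReal.tsum_le_of_sum_range_le fun n => ?_
  have hw := h.wald hX hm n
  have hA := Finset.sum_le_sum fun k (_ : k ∈ Finset.range n) =>
    hbound (h.measurableSet_A k) fun ω hω => hstep k ω (h.A_subset k hω)
  have hB := Finset.sum_le_sum fun k (_ : k ∈ Finset.range n) =>
    hbound (h.measurableSet_B k) fun ω hω => hstep k ω (h.swap.A_subset k hω)
  -- Weakening `b` to `b + c` here lets the three kinds of events recombine to total mass one.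
  have hC := hbound (h.measurableSet_C n) fun ω hω => (hCb n ω hω).trans (by linarith)
  have h1 := congrArg (· * (b + c)) (h.sum_real_add_real (P := P) n)
  simp only [Finset.sum_add_distrib, ← Finset.sum_mul, add_mul, one_mul] at hA hB hw h1
  have h2 : ∑ k ∈ Finset.range n, P (C k) = ENNReal.ofReal (∑ k ∈ Finset.range n, P.real (C k)) := by
    rw [ENNReal.ofReal_sum_of_nonneg fun _ _ => measureReal_nonneg]
    simp
  rw [h2]
  refine ENNReal.ofReal_le_ofReal ?_
  rw [le_div_iff₀ hm0]
  linarith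

/-- On each `A k` the density `exp (-S)` is at most `exp (-b)`; summing over the disjoint `A k`
leaves a `P`-probability. -/
theorem real_iUnion_le_exp_neg [IsProbabilityMeasure P] [IsProbabilityMeasure Q]
    (h : IsTestTree ℱ C A B) {b : ℝ}
    (hPQ : ∀ k E, MeasurableSet[ℱ k] E →
      ∫⁻ ω in E, ENNReal.ofReal (Real.exp (-∑ j ∈ Finset.range k, X j ω)) ∂P = Q E)
    (hb : ∀ k, ∀ ω ∈ A k, b ≤ ∑ j ∈ Finset.range (k + 1), X j ω) :
    Q.real (⋃ k, A k) ≤ Real.exp (-b) := by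
  refine ENNReal.toReal_le_of_le_ofReal (Real.exp_pos _).le ?_
  rw [measure_iUnion h.pairwise_disjoint h.measurableSet_A]
  calc ∑' k, Q (A k) ≤ ∑' k, ENNReal.ofReal (Real.exp (-b)) * P (A k) := by
        refine ENNReal.tsum_le_tsum fun k => ?_
        rw [← hPQ _ _ (h.measA k), ← setLIntegral_const]
        refine setLIntegral_mono measurable_const fun ω hω => ?_
        exact ENNReal.ofReal_le_ofReal (Real.exp_le_exp.2 (neg_le_neg (hb k ω hω)))
    _ = ENNReal.ofReal (Real.exp (-b)) * P (⋃ k, A k) := by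
        rw [ENNReal.tsum_mul_left, measure_iUnion h.pairwise_disjoint h.measurableSet_A]
    _ ≤ _ := mul_le_of_le_one_right' prob_le_one

/-- The density is strictly positive, so `Q`-null `A k` are `P`-null. A test that stops `P`-almost
surely would then always end in some `B k`. Positivity is what allows the error to tend to `0` from
the right. -/
theorem real_iUnion_pos [IsProbabilityMeasure P] [IsProbabilityMeasure Q]
    (h : IsTestTree ℱ C A B) (hX : ∀ k, Measurable (X k))
    (hPQ : ∀ k E, MeasurableSet[ℱ k] E →
      ∫⁻ ω in E, ENNReal.ofReal (Real.exp (-∑ j ∈ Finset.range k, X j ω)) ∂P = Q E)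
    {D : ℝ≥0∞} (hD : ∑' k, P (C k) ≤ D) (hD' : D ≠ ∞) (hB : P.real (⋃ k, B k) < 1) :
    0 < Q.real (⋃ k, A k) := by
  by_contra hneg
  have hQ : Q (⋃ k, A k) = 0 := by
    have := le_antisymm (not_lt.1 hneg) measureReal_nonneg
    rwa [measureReal_eq_zero_iff] at this
  have hP : ∀ k, P.real (A k) = 0 := by
    intro k
    have h1 := hPQ _ _ (h.measA k)
    rw [measure_mono_null (Set.subset_iUnion A k) hQ, lintegral_eq_zero_iff (by fun_prop)] at h1
    have h2 : ∀ᵐ ω ∂(P.restrict (A k)), False := by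
      filter_upwards [h1] with ω hω
      simp only [Pi.zero_apply, ENNReal.ofReal_eq_zero] at hω
      exact absurd (Real.exp_pos _) (not_lt.2 hω)
    rw [eventually_false_iff_eq_bot, ae_eq_bot, Measure.restrict_eq_zero] at h2
    simp [Measure.real, h2]
  refine absurd (le_of_tendsto' ((tendsto_real_C hD hD').const_sub 1) fun n => ?_)
    (by simpa using hB : ¬ (1 - 0 : ℝ) ≤ P.real (⋃ k, B k))
  have h1 := h.sum_real_add_real (P := P) n
  have h2 := h.swap.sum_real_le (P := P) n
  simp only [hP, zero_add] at h1
  linarith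

end IsTestTree

/-! ### Product structure of the path law: change of measure and independence. -/

open ProbabilityTheory

/-- It suffices to test boxes: there the indicator times the density is a product of functions of
single coordinates, which are independent. -/
theorem pi_withDensity_prod {ι α : Type*} [Fintype ι] {mα : MeasurableSpace α} (ρ σ : Measure α)
    [IsProbabilityMeasure ρ] [IsProbabilityMeasure σ] {f : α → ℝ≥0∞} (hf : Measurable f)
    (hσ : σ = ρ.withDensity f) :
    (Measure.pi fun _ : ι => ρ).withDensity (fun x => ∏ i, f (x i)) = Measure.pi fun _ : ι => σ := by
  symm
  refine Measure.pi_eq fun t ht => ?_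
  have hind : ∀ x : ι → α, (Set.univ.pi t).indicator (fun x => ∏ i, f (x i)) x
      = ∏ i, (t i).indicator f (x i) := by
    intro x
    by_cases hx : x ∈ Set.univ.pi t
    · rw [Set.indicator_of_mem hx]
      exact Finset.prod_congr rfl fun i _ => (Set.indicator_of_mem (hx i trivial) f).symm
    · rw [Set.indicator_of_notMem hx]
      simp only [Set.mem_pi, Set.mem_univ, true_implies, not_forall] at hx
      obtain ⟨i, hi⟩ := hx
      exact (Finset.prod_eq_zero (Finset.mem_univ i) (Set.indicator_of_notMem hi f)).symm
  have hmeas : ∀ i, Measurable ((t i).indicator f) := fun i => hf.indicator (ht i)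
  rw [withDensity_apply _ (MeasurableSet.univ_pi ht), ← lintegral_indicator (MeasurableSet.univ_pi ht)]
  simp_rw [hind]
  rw [lintegral_prod_eq_prod_lintegral_of_indepFun Finset.univ
    (fun i (x : ι → α) => (t i).indicator f (x i))
    (iIndepFun_pi fun i => (hmeas i).aemeasurable)
    (fun i => (hmeas i).comp (measurable_pi_apply i))]
  refine Finset.prod_congr rfl fun i _ => ?_
  rw [(measurePreserving_eval (fun _ : ι => ρ) i).lintegral_comp (hmeas i),
    lintegral_indicator (ht i), hσ, withDensity_apply _ (ht i)]

/-- The observations of the sensors in `M` at the first `k` times. -/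
def sensorHistory {s : ℕ} (M : Finset (Fin s)) (k : ℕ) (ω : Path s)
    (z : (Finset.range k ×ˢ M : Finset (ℕ × Fin s))) : ℝ :=
  ω z.1.1 z.1.2

@[fun_prop]
theorem measurable_sensorHistory {s : ℕ} (M : Finset (Fin s)) (k : ℕ) :
    Measurable (sensorHistory M k) := by
  unfold sensorHistory
  fun_prop

/-- The filtration generated by the observations of the sensors in `M`. -/
def sensorFiltration {s : ℕ} (M : Finset (Fin s)) :
    Filtration ℕ (inferInstance : MeasurableSpace (Path s)) where
  seq k := MeasurableSpace.comap (sensorHistory M k) inferInstance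
  mono' k l hkl := by
    have hsub : (Finset.range k ×ˢ M : Finset (ℕ × Fin s)) ⊆ Finset.range l ×ˢ M :=
      Finset.product_subset_product_left (Finset.range_mono hkl)
    have : sensorHistory M k = (fun x z => x ⟨z.1, hsub z.2⟩) ∘ sensorHistory M l := rfl
    change MeasurableSpace.comap _ _ ≤ MeasurableSpace.comap _ _
    rw [this, ← MeasurableSpace.comap_comp]
    refine MeasurableSpace.comap_mono ?_
    exact Measurable.comap_le (by fun_prop)
  le' k := (measurable_sensorHistory M k).comap_le

instance {s : ℕ} (ρ : Measure ℝ) [IsProbabilityMeasure ρ] : IsProbabilityMeasure (pathLaw s ρ) := by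
  unfold pathLaw
  infer_instance

/-- The product over times of products over sensors is one independent family indexed by pairs, and
any finite subfamily has the product law. -/
theorem map_sensorHistory {s : ℕ} (M : Finset (Fin s)) (k : ℕ) (ρ : Measure ℝ)
    [IsProbabilityMeasure ρ] :
    (pathLaw s ρ).map (sensorHistory M k) = Measure.pi fun _ => ρ := by
  have hind : iIndepFun (fun (p : ℕ × Fin s) (ω : Path s) => ω p.1 p.2) (pathLaw s ρ) := by
    have := iIndepFun_uncurry_infinitePi' (X := fun (_ : ℕ) (_ : Fin s) (x : ℝ) => x)
      (fun _ _ => ρ) (fun _ _ => measurable_id)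
    simp only [Measure.infinitePi_eq_pi] at this
    exact this
  have hmap : ∀ p : ℕ × Fin s, (pathLaw s ρ).map (fun ω => ω p.1 p.2) = ρ := by
    intro p
    have := (measurePreserving_eval (fun _ : Fin s => ρ) p.2).comp
      (measurePreserving_eval_infinitePi (fun _ : ℕ => Measure.pi fun _ : Fin s => ρ) p.1)
    exact this.map_eq
  have h := hind.precomp (g := (Subtype.val : (Finset.range k ×ˢ M : Finset (ℕ × Fin s)) → _))
    Subtype.val_injective
  rw [iIndepFun_iff_map_fun_eq_pi_map (fun z => Measurable.aemeasurable (by fun_prop))] at h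
  refine h.trans ?_
  congr 1
  funext z
  exact hmap z.1

/-- Change of measure on the observations of the sensors in `M`. -/
theorem setLIntegral_exp_sum {s : ℕ} (M : Finset (Fin s)) (ρ σ : Measure ℝ)
    [IsProbabilityMeasure ρ] [IsProbabilityMeasure σ] {g : ℝ → ℝ} (hg : Measurable g)
    (hσ : σ = ρ.withDensity fun x => ENNReal.ofReal (Real.exp (g x))) (k : ℕ) (E : Set (Path s))
    (hE : MeasurableSet[sensorFiltration M k] E) :
    ∫⁻ ω in E, ENNReal.ofReal (Real.exp (∑ j ∈ Finset.range k, ∑ i ∈ M, g (ω j i))) ∂(pathLaw s ρ)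
      = pathLaw s σ E := by
  -- The event depends on finitely many coordinates, so the claim reduces to finite product
  -- measures.
  obtain ⟨U, hU, rfl⟩ := hE
  have hf : Measurable fun x => ENNReal.ofReal (Real.exp (g x)) := by fun_prop
  have hdens : ∀ ω : Path s, ENNReal.ofReal (Real.exp (∑ j ∈ Finset.range k, ∑ i ∈ M, g (ω j i)))
      = ∏ z, ENNReal.ofReal (Real.exp (g (sensorHistory M k ω z))) := by
    intro ω
    rw [← Finset.sum_product' (f := fun j i => g (ω j i)), Real.exp_sum,
      ENNReal.ofReal_prod_of_nonneg fun _ _ => (Real.exp_pos _).le]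
    exact (Finset.prod_coe_sort _ fun z : ℕ × Fin s => ENNReal.ofReal (Real.exp (g (ω z.1 z.2)))).symm
  simp_rw [hdens]
  rw [← setLIntegral_map hU (by fun_prop) (measurable_sensorHistory M k) (μ := pathLaw s ρ)
    (f := fun x => ∏ z, ENNReal.ofReal (Real.exp (g (x z)))),
    ← Measure.map_apply (measurable_sensorHistory M k) hU, map_sensorHistory, map_sensorHistory,
    ← withDensity_apply _ hU, pi_withDensity_prod ρ σ hf hσ]

/-- With times indexed from `0`, the σ-algebra at stage `k` involves the indices below `k` only, so
observation `k` is the next, fresh one. -/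
theorem indep_sensorFiltration {s : ℕ} (M : Finset (Fin s)) (ρ : Measure ℝ)
    [IsProbabilityMeasure ρ] (k : ℕ) :
    Indep (sensorFiltration M k) (MeasurableSpace.comap (fun ω : Path s => ω k) inferInstance)
      (pathLaw s ρ) := by
  have hind : iIndepFun (fun (j : ℕ) (ω : Path s) => ω j) (pathLaw s ρ) :=
    iIndepFun_infinitePi (P := fun _ : ℕ => Measure.pi fun _ : Fin s => ρ) (X := fun _ x => x)
      fun _ => measurable_id
  have h := hind.indepFun_finset (Finset.range k) {k} (by simp) fun _ => by fun_prop
  refine indep_of_indep_of_le_left (indep_of_indep_of_le_right h ?_) ?_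
  · have : (fun ω : Path s => ω k)
        = (fun x => x ⟨k, by simp⟩) ∘ fun (ω : Path s) (j : ({k} : Finset ℕ)) => ω j := rfl
    rw [this, ← MeasurableSpace.comap_comp]
    exact MeasurableSpace.comap_mono (Measurable.comap_le (by fun_prop))
  · have : sensorHistory M k
        = (fun (x : Finset.range k → Fin s → ℝ) (z : (Finset.range k ×ˢ M : Finset (ℕ × Fin s))) =>
          x ⟨z.1.1, (Finset.mem_product.1 z.2).1⟩ z.1.2) ∘
          fun (ω : Path s) (j : Finset.range k) => ω j := rfl
    change MeasurableSpace.comap (sensorHistory M k) _ ≤ _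
    rw [this, ← MeasurableSpace.comap_comp]
    exact MeasurableSpace.comap_mono (Measurable.comap_le (by fun_prop))

theorem measurePreserving_observation {s : ℕ} (ρ : Measure ℝ) [IsProbabilityMeasure ρ] (k : ℕ) :
    MeasurePreserving (fun ω : Path s => ω k) (pathLaw s ρ) (Measure.pi fun _ => ρ) :=
  measurePreserving_eval_infinitePi (fun _ : ℕ => Measure.pi fun _ : Fin s => ρ) k

/-- Supplies the drift hypothesis of Wald's identity: the event of still running after `k`
observations is independent of the next one. -/
theorem setIntegral_observation {s : ℕ} (M : Finset (Fin s)) (ρ : Measure ℝ)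
    [IsProbabilityMeasure ρ] (k : ℕ) {φ : (Fin s → ℝ) → ℝ} (hφ : Measurable φ) {E : Set (Path s)}
    (hE : MeasurableSet[sensorFiltration M k] E) :
    ∫ ω in E, φ (ω k) ∂(pathLaw s ρ)
      = (pathLaw s ρ).real E * ∫ x, φ x ∂(Measure.pi fun _ : Fin s => ρ) := by
  rw [Indep.setIntegral_eq_mul ((sensorFiltration M).le k) (indep_sensorFiltration M ρ k)
    (measurable_pi_apply k).aemeasurable hE hφ.aestronglyMeasurable,
    ← (measurePreserving_observation ρ k).map_eq,
    integral_map (measurable_pi_apply k).aemeasurable hφ.aestronglyMeasurable]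

/-! ### Detection strategies as test trees. -/

namespace Strategy

variable {s : ℕ}

/-- The event that the test is still running after `k` observations. -/
def running (f : Strategy s) (k : ℕ) : Set (Path s) :=
  {ω | ∀ j < k, f.detect j (history j ω) = Decision.cont}

/-- The event that the test stops at observation `k + 1` with decision `d`. -/
def stopsAt (f : Strategy s) (d : Decision) (k : ℕ) : Set (Path s) :=
  {ω | f.detect k (history k ω) = d ∧ ω ∈ f.running k}

theorem decides_eq_iUnion (f : Strategy s) (d : Decision) : f.decides d = ⋃ k, f.stopsAt d k := by
  ext ω
  simp [decides, stopsAt, running]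

theorem measurableSet_detect_eq {f : Strategy s} {M : Finset (Fin s)} (hf : f.BasedOn M) (k : ℕ)
    (d : Decision) :
    MeasurableSet[sensorFiltration M (k + 1)] {ω | f.detect k (history k ω) = d} := by
  classical
  -- A full history is rebuilt from the sensors in `M` with value `0` elsewhere; `BasedOn` makes the
  -- filler immaterial.
  let e : ((Finset.range (k + 1) ×ˢ M : Finset (ℕ × Fin s)) → ℝ) → Fin (k + 1) → Fin s → ℝ :=
    fun x j i => if h : i ∈ M then
      x ⟨(j, i), Finset.mem_product.2 ⟨Finset.mem_range.2 j.2, h⟩⟩ else 0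
  have he : Measurable e := by
    refine measurable_pi_lambda _ fun j => measurable_pi_lambda _ fun i => ?_
    by_cases h : i ∈ M
    · simp only [e, h, dite_true]; fun_prop
    · simp only [e, h, dite_false]; fun_prop
  refine ⟨{x | f.detect k (e x) = d}, (f.measurable_detect k).comp he (MeasurableSpace.measurableSet_top
    (s := {d})), ?_⟩
  ext ω
  simp only [Set.mem_preimage, Set.mem_ofPred_eq]
  rw [hf k (e (sensorHistory M (k + 1) ω)) (history k ω)]
  intro j i hi
  simp [e, hi, sensorHistory, history]

theorem measurableSet_running {f : Strategy s} {M : Finset (Fin s)} (hf : f.BasedOn M) (k : ℕ) :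
    MeasurableSet[sensorFiltration M k] (f.running k) := by
  have : f.running k = ⋂ j, ⋂ (_ : j < k), {ω | f.detect j (history j ω) = Decision.cont} := by
    ext ω; simp [running]
  rw [this]
  exact MeasurableSet.iInter fun j => MeasurableSet.iInter fun hj =>
    (sensorFiltration M).mono (Nat.succ_le_of_lt hj) _ (measurableSet_detect_eq hf j _)

theorem isTestTree {f : Strategy s} {M : Finset (Fin s)} (hf : f.BasedOn M) :
    IsTestTree (sensorFiltration M) f.running (f.stopsAt Decision.one)
      (f.stopsAt Decision.zero) where
  zero := by ext ω; simp [running]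
  measC k := measurableSet_running hf k
  measA k := (measurableSet_detect_eq hf k _).inter
    ((sensorFiltration M).mono k.le_succ _ (measurableSet_running hf k))
  measB k := (measurableSet_detect_eq hf k _).inter
    ((sensorFiltration M).mono k.le_succ _ (measurableSet_running hf k))
  split k := by
    ext ω
    simp only [running, stopsAt, Set.mem_ofPred_eq, Set.mem_union, Nat.forall_lt_succ_right]
    cases f.detect k (history k ω) <;> simp
  disjC k := by
    rw [Set.disjoint_left]
    rintro ω h1 (h2 | h2) <;> · have := (h1 k k.lt_succ_self).symm.trans h2.1; contradiction
  disjAB k := by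
    rw [Set.disjoint_left]
    rintro ω h1 h2
    have := h1.1.symm.trans h2.1
    contradiction

/-- `T` counts the `k ≥ 0` with `k < T`, also when `T` is infinite. Integrating termwise gives the
tail-sum formula for the mean of `T`. -/
theorem stopTime_eq_tsum (f : Strategy s) (ω : Path s) :
    (f.stopTime ω : ℝ≥0∞) = ∑' k, (f.running k).indicator 1 ω := by
  classical
  by_cases h : ∃ k, f.detect k (history k ω) ≠ Decision.cont
  · have hT : f.stopTime ω = ((Nat.find h + 1 : ℕ) : ℕ∞) := by
      refine le_antisymm (iInf₂_le (Nat.find h) (Nat.find_spec h)) (le_iInf₂ fun k hk => ?_)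
      exact_mod_cast Nat.succ_le_succ (Nat.find_min' h hk)
    have hrun : ∀ k, ω ∈ f.running k ↔ k ∈ Finset.range (Nat.find h + 1) := by
      intro k
      rw [Finset.mem_range, Nat.lt_succ_iff, Nat.le_find_iff]
      simp [running]
    rw [tsum_eq_sum (s := Finset.range (Nat.find h + 1)) fun k hk =>
      Set.indicator_of_notMem (mt (hrun k).1 hk) _,
      Finset.sum_congr rfl fun k hk => Set.indicator_of_mem ((hrun k).2 hk) _, hT]
    simp
  · push Not at h
    have hT : f.stopTime ω = ⊤ := by simp [stopTime, h]
    have hrun : ∀ k, (f.running k).indicator (1 : Path s → ℝ≥0∞) ω = 1 :=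
      fun k => Set.indicator_of_mem (s := f.running k) (fun j _ => h j) _
    simp [hT, hrun]

theorem lintegral_stopTime {f : Strategy s} {M : Finset (Fin s)} (hf : f.BasedOn M)
    (P : Measure (Path s)) :
    ∫⁻ ω, (f.stopTime ω : ℝ≥0∞) ∂P = ∑' k, P (f.running k) := by
  have hm := (isTestTree hf).measurableSet_C
  simp_rw [stopTime_eq_tsum]
  rw [lintegral_tsum fun k => (measurable_one.indicator (hm k)).aemeasurable]
  simp_rw [lintegral_indicator_one (hm _)]

end Strategy

/-! ### Delay and error bounds for walks with log-likelihood steps, under a generic pair of laws. -/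

section LogLikelihood

variable {s : ℕ} {M : Finset (Fin s)} {ρ σ : Measure ℝ} [IsProbabilityMeasure ρ]
  [IsProbabilityMeasure σ] {g : ℝ → ℝ} {C A B : ℕ → Set (Path s)}

theorem integrable_sum_sensors (hgi : Integrable g ρ) :
    Integrable (fun x : Fin s → ℝ => ∑ i ∈ M, g (x i)) (Measure.pi fun _ => ρ) :=
  integrable_finsetSum _ fun _ _ => integrable_comp_eval hgi

theorem integral_sum_sensors (hgi : Integrable g ρ) :
    ∫ x : Fin s → ℝ, ∑ i ∈ M, g (x i) ∂(Measure.pi fun _ => ρ) = M.card * ∫ x, g x ∂ρ := by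
  rw [integral_finsetSum _ fun _ _ => integrable_comp_eval hgi]
  simp [integral_comp_eval (μ := fun _ : Fin s => ρ) hgi.1]

theorem setLIntegral_exp_neg_sum (hg : Measurable g)
    (hσ : σ = ρ.withDensity fun x => ENNReal.ofReal (Real.exp (-g x))) (k : ℕ) (E : Set (Path s))
    (hE : MeasurableSet[sensorFiltration M k] E) :
    ∫⁻ ω in E, ENNReal.ofReal (Real.exp (-∑ j ∈ Finset.range k, ∑ i ∈ M, g (ω j i))) ∂(pathLaw s ρ)
      = pathLaw s σ E := by
  rw [← setLIntegral_exp_sum M ρ σ hg.neg hσ k E hE]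
  simp

/-- Wald's lower bound for the average sample number, in terms of the error probabilities. -/
theorem mul_log_le_delay (t : IsTestTree (sensorFiltration M) C A B) (hg : Measurable g)
    (hgi : Integrable g ρ) (hm : 0 ≤ ∫ x, g x ∂ρ)
    (hσ : σ = ρ.withDensity fun x => ENNReal.ofReal (Real.exp (-g x)))
    {D : ℝ≥0∞} (hD : ∑' k, pathLaw s ρ (C k) ≤ D) (hD' : D ≠ ∞)
    (hA : 0 < (pathLaw s σ).real (⋃ k, A k)) :
    (1 - (pathLaw s ρ).real (⋃ k, B k)) * Real.log (1 / (pathLaw s σ).real (⋃ k, A k))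
      ≤ M.card * (∫ x, g x ∂ρ) * D.toReal + 1 := by
  have hpos : 0 < 1 / (pathLaw s σ).real (⋃ k, A k) := one_div_pos.2 hA
  have h := t.mul_le_mul_delay_add (P := pathLaw s ρ) (Q := pathLaw s σ)
    (X := fun k ω => ∑ i ∈ M, g (ω k i)) (m := M.card * ∫ x, g x ∂ρ) (by positivity)
    (fun k => (measurePreserving_observation ρ k).integrable_comp_of_integrable
      (integrable_sum_sensors hgi))
    (fun k => by
      rw [← integral_sum_sensors hgi]
      exact setIntegral_observation M ρ k (φ := fun x => ∑ i ∈ M, g (x i)) (by fun_prop) (t.measC k))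
    (setLIntegral_exp_neg_sum hg hσ) hD hD'
    -- This level makes `exp g * Q A` equal to `1`, which is the additive constant in the
    -- conclusion.
    (g := Real.log (1 / (pathLaw s σ).real (⋃ k, A k)))
    (Real.log_nonneg ((one_le_div hA).2 measureReal_le_one))
  rwa [Real.exp_log hpos, one_div_mul_cancel hA.ne'] at h

/-- The events of a test on the sensors in `M` which runs while the random walk with steps
`∑ i ∈ M, g (x i)` lies between `-a` and `b`, and stops once it is outside. -/
structure IsThresholdTree (M : Finset (Fin s)) (g : ℝ → ℝ) (a b : ℝ) (C A B : ℕ → Set (Path s)) :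
    Prop extends IsTestTree (sensorFiltration M) C A B where
  le_upper : ∀ k, ∀ ω ∈ C k, ∑ j ∈ Finset.range k, ∑ i ∈ M, g (ω j i) ≤ b
  lower_le : ∀ k, ∀ ω ∈ C k, -a ≤ ∑ j ∈ Finset.range k, ∑ i ∈ M, g (ω j i)
  upper_le : ∀ k, ∀ ω ∈ A k, b ≤ ∑ j ∈ Finset.range (k + 1), ∑ i ∈ M, g (ω j i)
  le_lower : ∀ k, ∀ ω ∈ B k, ∑ j ∈ Finset.range (k + 1), ∑ i ∈ M, g (ω j i) ≤ -a

/-- The mean increment, truncated from above at `c`. -/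
def truncatedMean (M : Finset (Fin s)) (g : ℝ → ℝ) (ρ : Measure ℝ) (c : ℝ) : ℝ :=
  ∫ x : Fin s → ℝ, min (∑ i ∈ M, g (x i)) c ∂(Measure.pi fun _ => ρ)

/-- Cutting from above at a nonnegative level never increases the absolute value, so the untruncated
sum dominates. -/
theorem tendsto_truncatedMean (hg : Measurable g) (hgi : Integrable g ρ) :
    Tendsto (fun n : ℕ => truncatedMean M g ρ n) atTop (𝓝 (M.card * ∫ x, g x ∂ρ)) := by
  rw [← integral_sum_sensors hgi]
  refine tendsto_integral_of_dominated_convergence _ (fun n => ?_)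
    (integrable_sum_sensors (M := M) hgi).norm (fun n => ae_of_all _ fun x => ?_)
    (ae_of_all _ fun x => ?_)
  · exact Measurable.aestronglyMeasurable (by fun_prop)
  · rw [Real.norm_eq_abs, Real.norm_eq_abs]
    have hn : (0 : ℝ) ≤ n := n.cast_nonneg
    rcases min_cases (∑ i ∈ M, g (x i)) (n : ℝ) with h | h
    · rw [h.1]
    · rw [h.1, abs_of_nonneg hn]
      exact h.2.le.trans (le_abs_self _)
  · obtain ⟨N, hN⟩ := exists_nat_ge (∑ i ∈ M, g (x i))
    refine tendsto_const_nhds.congr' ?_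
    filter_upwards [eventually_ge_atTop N] with n hn
    rw [min_eq_left (hN.trans (Nat.cast_le.2 hn))]

namespace IsThresholdTree

variable {a b : ℝ}

/-- Exchanging the hypotheses negates the walk, so each bound proved for one decision yields the one
for the other. -/
theorem swap (h : IsThresholdTree M g a b C A B) :
    IsThresholdTree M (fun x => -g x) b a C B A where
  toIsTestTree := h.toIsTestTree.swap
  le_upper k ω hω := by simpa using neg_le_neg (h.lower_le k ω hω)
  lower_le k ω hω := by simpa using neg_le_neg (h.le_upper k ω hω)
  upper_le k ω hω := by simpa using neg_le_neg (h.le_lower k ω hω)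
  le_lower k ω hω := by simpa using neg_le_neg (h.upper_le k ω hω)

theorem tsum_le (h : IsThresholdTree M g a b C A B) (hg : Measurable g) (hgi : Integrable g ρ)
    {c : ℝ} (hc : 0 ≤ c) (hm : 0 < truncatedMean M g ρ c) :
    ∑' k, pathLaw s ρ (C k) ≤ ENNReal.ofReal ((b + c) / truncatedMean M g ρ c) :=
  h.tsum_le_of_lt (P := pathLaw s ρ) (X := fun k ω => ∑ i ∈ M, g (ω k i)) hc hm
    (fun k => (measurePreserving_observation ρ k).integrable_comp_of_integrable
      (g := fun x => min (∑ i ∈ M, g (x i)) c)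
      ((integrable_sum_sensors hgi).inf (integrable_const _)))
    (fun k => setIntegral_observation M ρ k (φ := fun x => min (∑ i ∈ M, g (x i)) c) (by fun_prop)
      (h.measC k)) h.le_upper

theorem real_le_exp_neg (h : IsThresholdTree M g a b C A B) (hg : Measurable g)
    (hσ : σ = ρ.withDensity fun x => ENNReal.ofReal (Real.exp (-g x))) :
    (pathLaw s σ).real (⋃ k, A k) ≤ Real.exp (-b) :=
  h.real_iUnion_le_exp_neg (P := pathLaw s ρ) (X := fun k ω => ∑ i ∈ M, g (ω k i))
    (setLIntegral_exp_neg_sum hg hσ) h.upper_le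

theorem real_pos (h : IsThresholdTree M g a b C A B) (hg : Measurable g)
    (hσ : σ = ρ.withDensity fun x => ENNReal.ofReal (Real.exp (-g x)))
    {D : ℝ≥0∞} (hD : ∑' k, pathLaw s ρ (C k) ≤ D) (hD' : D ≠ ∞)
    (hB : (pathLaw s ρ).real (⋃ k, B k) < 1) :
    0 < (pathLaw s σ).real (⋃ k, A k) :=
  h.real_iUnion_pos (P := pathLaw s ρ) (X := fun k ω => ∑ i ∈ M, g (ω k i)) (fun k => by fun_prop)
    (setLIntegral_exp_neg_sum hg hσ) hD hD' hB

/-- Lets thresholds be replaced by logarithmic errors in upper bounds on the delay. -/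
theorem le_log (h : IsThresholdTree M g a b C A B) (hg : Measurable g)
    (hσ : σ = ρ.withDensity fun x => ENNReal.ofReal (Real.exp (-g x)))
    (hA : 0 < (pathLaw s σ).real (⋃ k, A k)) :
    b ≤ Real.log (1 / (pathLaw s σ).real (⋃ k, A k)) := by
  have := Real.log_le_log hA (h.real_le_exp_neg hg hσ)
  rw [Real.log_exp] at this
  rw [one_div, Real.log_inv]
  linarith

end IsThresholdTree

theorem eventually_truncatedMean_pos (hM : M.Nonempty) (hg : Measurable g) (hgi : Integrable g ρ)
    (hm : 0 < ∫ x, g x ∂ρ) : ∀ᶠ n : ℕ in atTop, 0 < truncatedMean M g ρ n := by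
  have : (0 : ℝ) < M.card := by exact_mod_cast hM.card_pos
  exact (tendsto_truncatedMean hg hgi).eventually_const_lt (by positivity)

theorem IsThresholdTree.real_pos_of_pos {a b : ℝ} (h : IsThresholdTree M g a b C A B)
    (hM : M.Nonempty) (hg : Measurable g) (hgi : Integrable g ρ) (hm : 0 < ∫ x, g x ∂ρ)
    (hσ : σ = ρ.withDensity fun x => ENNReal.ofReal (Real.exp (-g x)))
    (hB : (pathLaw s ρ).real (⋃ k, B k) < 1) : 0 < (pathLaw s σ).real (⋃ k, A k) := by
  obtain ⟨n, hn⟩ := (eventually_truncatedMean_pos hM hg hgi hm).exists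
  exact h.real_pos hg hσ (h.tsum_le hg hgi n.cast_nonneg hn) ENNReal.ofReal_ne_top hB

/-- With both thresholds equal to `n`, the logarithm of the error probability is asymptotic
to `-n`. -/
theorem tendsto_log_div (hM : M.Nonempty) (hg : Measurable g) (hgi : Integrable g ρ)
    (hm : 0 < ∫ x, g x ∂ρ)
    (hσ : σ = ρ.withDensity fun x => ENNReal.ofReal (Real.exp (-g x)))
    {C A B : ℕ → ℕ → Set (Path s)} (h : ∀ n : ℕ, IsThresholdTree M g (n + 1) (n + 1) (C n) (A n) (B n))
    (hB : ∀ n : ℕ, (pathLaw s ρ).real (⋃ k, B n k) ≤ Real.exp (-(n + 1))) :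
    Tendsto (fun n : ℕ => Real.log (1 / (pathLaw s σ).real (⋃ k, A n k)) / (n + 1)) atTop (𝓝 1) := by
  have hB1 : ∀ n : ℕ, Real.exp (-((n : ℝ) + 1)) < 1 := fun n => by
    rw [Real.exp_lt_one_iff]
    linarith [n.cast_nonneg (α := ℝ)]
  have hA : ∀ n, 0 < (pathLaw s σ).real (⋃ k, A n k) := fun n =>
    (h n).real_pos_of_pos hM hg hgi hm hσ ((hB n).trans_lt (hB1 n))
  have hlow : ∀ n : ℕ, 1 ≤ Real.log (1 / (pathLaw s σ).real (⋃ k, A n k)) / (n + 1) := fun n => by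
    rw [le_div_iff₀ (by positivity), one_mul]
    exact (h n).le_log hg hσ (hA n)
  have hcard : (0 : ℝ) < M.card := by exact_mod_cast hM.card_pos
  have hmm : 0 < M.card * ∫ x, g x ∂ρ := by positivity
  rw [tendsto_order]
  refine ⟨fun y hy => Eventually.of_forall fun n => hy.trans_le (hlow n), fun y hy => ?_⟩
  have hlim : Tendsto (fun n : ℕ => (M.card * ∫ x, g x ∂ρ) / truncatedMean M g ρ n) atTop (𝓝 1) := by
    have := (tendsto_const_nhds (x := M.card * ∫ x, g x ∂ρ)).div
      (tendsto_truncatedMean (M := M) hg hgi) hmm.ne'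
    rwa [div_self hmm.ne'] at this
  -- The truncation level is fixed first, with true drift over truncated drift below `y`; only then
  -- does `n` grow.
  obtain ⟨c, hcpos, hcy⟩ := ((eventually_truncatedMean_pos hM hg hgi hm).and
    (hlim.eventually_lt_const hy)).exists
  have hinv : Tendsto (fun n : ℕ => 1 / ((n : ℝ) + 1)) atTop (𝓝 0) :=
    tendsto_one_div_add_atTop_nhds_zero_nat
  have hexp : Tendsto (fun n : ℕ => Real.exp (-((n : ℝ) + 1))) atTop (𝓝 0) :=
    Real.tendsto_exp_neg_atTop_nhds_zero.comp
      (tendsto_atTop_add_const_right _ _ tendsto_natCast_atTop_atTop)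
  -- Inserting `D = (n + 1 + c) / m_c` into Wald's lower bound for the delay and dividing by `n + 1`
  -- bounds the ratio by this expression.
  have hub : Tendsto (fun n : ℕ => ((M.card * ∫ x, g x ∂ρ) / truncatedMean M g ρ c
      * (1 + c * (1 / ((n : ℝ) + 1))) + 1 / ((n : ℝ) + 1)) / (1 - Real.exp (-((n : ℝ) + 1)))) atTop
      (𝓝 (((M.card * ∫ x, g x ∂ρ) / truncatedMean M g ρ c * (1 + c * 0) + 0) / (1 - 0))) :=
    ((((hinv.const_mul _).const_add _).const_mul _).add hinv).div (hexp.const_sub 1) (by norm_num)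
  simp only [mul_zero, add_zero, sub_zero, mul_one, div_one] at hub
  filter_upwards [hub.eventually_lt_const hcy] with n hn
  refine lt_of_le_of_lt ?_ hn
  have hD := (h n).tsum_le hg hgi c.cast_nonneg hcpos
  have hl := mul_log_le_delay (h n).toIsTestTree hg hgi hm.le hσ hD ENNReal.ofReal_ne_top (hA n)
  have hn0 : (0 : ℝ) < n + 1 := by positivity
  rw [ENNReal.toReal_ofReal (by positivity)] at hl
  have hl0 : 0 ≤ Real.log (1 / (pathLaw s σ).real (⋃ k, A n k)) :=
    hn0.le.trans ((h n).le_log hg hσ (hA n))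
  have hb := mul_le_mul_of_nonneg_right
    (show 1 - Real.exp (-((n : ℝ) + 1)) ≤ 1 - (pathLaw s ρ).real (⋃ k, B n k) by linarith [hB n]) hl0
  rw [le_div_iff₀ (by linarith [hB1 n]), div_mul_eq_mul_div, div_le_iff₀ hn0]
  refine (mul_comm _ _).le.trans (hb.trans (hl.trans (le_of_eq ?_)))
  field_simp

end LogLikelihood

/-! ### The two hypotheses: densities and Wald's bounds for both errors. -/

variable {s : ℕ} {M : Finset (Fin s)} {ν μ : Measure ℝ} [IsProbabilityMeasure ν]
  [IsProbabilityMeasure μ]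

/-- By mutual absolute continuity the derivative is almost everywhere positive and finite, so the
conventions for `log 0` and `toReal ∞` play no role. -/
theorem eq_withDensity_exp_llr (hμν : μ ≪ ν) (hνμ : ν ≪ μ) :
    μ = ν.withDensity fun x => ENNReal.ofReal (Real.exp (llr μ ν x)) := by
  conv_lhs => rw [← Measure.withDensity_rnDeriv_eq μ ν hμν]
  refine withDensity_congr_ae ?_
  filter_upwards [exp_llr_of_ac' μ ν hνμ, μ.rnDeriv_lt_top ν] with x hx hx'
  rw [hx, ENNReal.ofReal_toReal hx'.ne]

theorem eq_withDensity_exp_neg_llr (hμν : μ ≪ ν) (hνμ : ν ≪ μ) :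
    ν = μ.withDensity fun x => ENNReal.ofReal (Real.exp (-llr μ ν x)) := by
  conv_lhs => rw [← Measure.withDensity_rnDeriv_eq ν μ hνμ]
  refine withDensity_congr_ae ?_
  filter_upwards [exp_neg_llr hμν, ν.rnDeriv_lt_top μ] with x hx hx'
  rw [hx, ENNReal.ofReal_toReal hx'.ne]

namespace Strategy

theorem errorI_eq (f : Strategy s) :
    f.errorI ν = (pathLaw s ν).real (⋃ k, f.stopsAt Decision.one k) := by
  rw [errorI, decides_eq_iUnion]

theorem errorII_eq (f : Strategy s) :
    f.errorII μ = (pathLaw s μ).real (⋃ k, f.stopsAt Decision.zero k) := by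
  rw [errorII, decides_eq_iUnion]

theorem delay_eq {f : Strategy s} (hf : f.BasedOn M) :
    f.delay ν μ = max (∑' k, pathLaw s ν (f.running k)) (∑' k, pathLaw s μ (f.running k)) := by
  rw [delay, lintegral_stopTime hf, lintegral_stopTime hf]

theorem mul_log_errorI_le {f : Strategy s} (hf : f.BasedOn M) (hμν : μ ≪ ν) (hνμ : ν ≪ μ)
    (hint1 : Integrable (llr μ ν) μ) (hI1 : 0 < klOne ν μ) (hD : f.delay ν μ ≠ ∞)
    (hα : 0 < f.errorI ν) :
    (1 - f.errorII μ) * Real.log (1 / f.errorI ν)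
      ≤ M.card * klOne ν μ * (f.delay ν μ).toReal + 1 := by
  rw [errorI_eq] at hα ⊢
  rw [errorII_eq]
  exact mul_log_le_delay (isTestTree hf) (measurable_llr μ ν) hint1 hI1.le
    (eq_withDensity_exp_neg_llr hμν hνμ) (by rw [delay_eq hf]; exact le_max_right _ _) hD hα

theorem mul_log_errorII_le {f : Strategy s} (hf : f.BasedOn M) (hμν : μ ≪ ν) (hνμ : ν ≪ μ)
    (hint0 : Integrable (llr μ ν) ν) (hI0 : 0 < klZero ν μ) (hD : f.delay ν μ ≠ ∞)
    (hβ : 0 < f.errorII μ) :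
    (1 - f.errorI ν) * Real.log (1 / f.errorII μ)
      ≤ M.card * klZero ν μ * (f.delay ν μ).toReal + 1 := by
  rw [errorII_eq] at hβ ⊢
  rw [errorI_eq]
  rw [klZero, ← integral_neg] at hI0 ⊢
  exact mul_log_le_delay (isTestTree hf).swap (measurable_llr μ ν).neg hint0.neg hI0.le
    (by simpa using eq_withDensity_exp_llr hμν hνμ)
    (by rw [delay_eq hf]; exact le_max_left _ _) hD hβ

end Strategy

/-! ### Limiting regimes and the converse bound. -/

section Regimes

variable {ι : Type*} {f : ι → Strategy s}

theorem tendsto_errorI_balanced :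
    Tendsto (fun i => (f i).errorI ν) (balancedErrors ν μ f) (𝓝[>] 0) :=
  tendsto_comap.mono_left (inf_le_left.trans inf_le_left)

theorem tendsto_errorII_balanced :
    Tendsto (fun i => (f i).errorII μ) (balancedErrors ν μ f) (𝓝[>] 0) :=
  tendsto_comap.mono_left (inf_le_left.trans inf_le_right)

theorem tendsto_log_one_div_atTop {l : Filter ι} {e : ι → ℝ} (h : Tendsto e l (𝓝[>] 0)) :
    Tendsto (fun i => Real.log (1 / e i)) l atTop := by
  simp_rw [one_div]
  exact Real.tendsto_log_atTop.comp (tendsto_inv_nhdsGT_zero.comp h)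

theorem tendsto_log_ratio_balanced :
    Tendsto (fun i => Real.log (1 / (f i).errorII μ) / Real.log (1 / (f i).errorI ν))
      (balancedErrors ν μ f) (𝓝 1) := by
  have h : Tendsto (fun i => Real.log ((f i).errorI ν) / Real.log ((f i).errorII μ))
      (balancedErrors ν μ f) (𝓝 1) := tendsto_comap.mono_left inf_le_right
  have h' := h.inv₀ one_ne_zero
  rw [inv_one] at h'
  refine h'.congr fun i => ?_
  rw [inv_div, one_div, one_div, Real.log_inv, Real.log_inv, neg_div_neg_eq]

/-- Reduces every limit statement to the relaxed regime. -/
theorem equalErrors_le_balancedErrors : equalErrors ν μ f ≤ balancedErrors ν μ f := by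
  have h1 : Tendsto (fun i => (f i).errorI ν) (equalErrors ν μ f) (𝓝[>] 0) :=
    tendsto_comap.mono_left inf_le_left
  have h2 : ∀ᶠ i in equalErrors ν μ f, (f i).errorI ν = (f i).errorII μ :=
    mem_inf_of_right (mem_principal_self _)
  refine le_inf (le_inf h1.le_comap (Tendsto.le_comap (h1.congr' h2))) (Tendsto.le_comap ?_)
  refine tendsto_const_nhds.congr' ?_
  filter_upwards [h2, (tendsto_log_one_div_atTop h1).eventually_gt_atTop 0] with i hi hlog
  rw [one_div, Real.log_inv] at hlog
  rw [← hi, div_self (by linarith)]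

/-- A convergent majorant, rather than a bound on the upper limit, restricts to finer regimes and
also serves as the upper half of the limit for the sum-SPRT. -/
theorem exists_efficiency_le_tendsto (hf : ∀ i, (f i).BasedOn M) (hμν : μ ≪ ν) (hνμ : ν ≪ μ)
    (hint0 : Integrable (llr μ ν) ν) (hint1 : Integrable (llr μ ν) μ)
    (hI0 : 0 < klZero ν μ) (hI1 : 0 < klOne ν μ) :
    ∃ h : ι → ℝ≥0∞, (∀ᶠ i in balancedErrors ν μ f, (f i).efficiency ν μ ≤ h i) ∧
      Tendsto h (balancedErrors ν μ f)
        (𝓝 (ENNReal.ofReal (M.card * min (klZero ν μ) (klOne ν μ)))) := by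
  set l := balancedErrors ν μ f
  set u : ι → ℝ := fun i => Real.log (1 / (f i).errorI ν)
  set v : ι → ℝ := fun i => Real.log (1 / (f i).errorII μ)
  have hα : Tendsto (fun i => (f i).errorI ν) l (𝓝[>] 0) := tendsto_errorI_balanced
  have hβ : Tendsto (fun i => (f i).errorII μ) l (𝓝[>] 0) := tendsto_errorII_balanced
  have hu : Tendsto u l atTop := tendsto_log_one_div_atTop hα
  have hvu : Tendsto (fun i => v i / u i) l (𝓝 1) := tendsto_log_ratio_balanced
  have hα0 := tendsto_nhds_of_tendsto_nhdsWithin hα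
  have hβ0 := tendsto_nhds_of_tendsto_nhdsWithin hβ
  have hθ1 : Tendsto (fun i => 1 - (f i).errorII μ - (u i)⁻¹) l (𝓝 1) := by
    simpa using (hβ0.const_sub 1).sub hu.inv_tendsto_atTop
  have hθ0 : Tendsto (fun i => (1 - (f i).errorI ν) * (v i / u i) - (u i)⁻¹) l (𝓝 1) := by
    simpa using ((hα0.const_sub 1).mul hvu).sub hu.inv_tendsto_atTop
  -- Wald's bounds for the two errors, with the additive `1` moved to the left, solved for `u / D`;
  -- in the one for `β`, the logarithm `v` is written as `(v / u) * u`.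
  refine ⟨fun i => ENNReal.ofReal (min
    (M.card * klZero ν μ / ((1 - (f i).errorI ν) * (v i / u i) - (u i)⁻¹))
    (M.card * klOne ν μ / (1 - (f i).errorII μ - (u i)⁻¹))), ?_, ?_⟩
  · filter_upwards [hu.eventually_gt_atTop 0, hα self_mem_nhdsWithin, hβ self_mem_nhdsWithin,
      hθ1.eventually_const_lt one_pos, hθ0.eventually_const_lt one_pos] with i hui hαi hβi h1 h0
    by_cases hD : (f i).delay ν μ = ∞
    · simp [Strategy.efficiency, hD]
    have e1 := Strategy.mul_log_errorI_le (hf i) hμν hνμ hint1 hI1 hD hαi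
    have e0 := Strategy.mul_log_errorII_le (hf i) hμν hνμ hint0 hI0 hD hβi
    refine ENNReal.div_le_of_le_mul ?_
    rw [← ENNReal.ofReal_toReal hD, ← ENNReal.ofReal_mul' ENNReal.toReal_nonneg]
    refine ENNReal.ofReal_le_ofReal ?_
    rw [min_mul_of_nonneg _ _ ENNReal.toReal_nonneg]
    refine le_min ?_ ?_
    · rw [div_mul_eq_mul_div, le_div_iff₀ h0]
      have : u i * ((1 - (f i).errorI ν) * (v i / u i) - (u i)⁻¹)
          = (1 - (f i).errorI ν) * v i - 1 := by field_simp
      exact this.le.trans (by linarith)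
    · rw [div_mul_eq_mul_div, le_div_iff₀ h1]
      have : u i * (1 - (f i).errorII μ - (u i)⁻¹) = (1 - (f i).errorII μ) * u i - 1 := by
        field_simp
      exact this.le.trans (by linarith)
  · refine ENNReal.tendsto_ofReal ?_
    rw [mul_min_of_nonneg _ _ (Nat.cast_nonneg _)]
    have h0 := (tendsto_const_nhds (x := M.card * klZero ν μ)).div hθ0 one_ne_zero
    have h1 := (tendsto_const_nhds (x := M.card * klOne ν μ)).div hθ1 one_ne_zero
    rw [div_one] at h0 h1
    exact h0.min h1

theorem limsup_le_of_eventually_le_tendsto {l : Filter ι} {e h : ι → ℝ≥0∞} {C : ℝ≥0∞}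
    (he : ∀ᶠ i in l, e i ≤ h i) (hh : Tendsto h l (𝓝 C)) : limsup e l ≤ C := by
  -- A family may fail to realise the regime at all; the upper limit along the trivial filter is
  -- `0`.
  rcases l.eq_or_neBot with rfl | _
  · simp
  · exact (limsup_le_limsup he).trans hh.limsup_eq.le

end Regimes

/-! ### The sum-SPRT attains the bound. -/

section SumSPRT

theorem sumSPRT_basedOn {ν μ : Measure ℝ} (p : Thresholds) : (sumSPRT ν μ M p).BasedOn M := by
  intro k x y hxy
  have : cumLLR ν μ M k x = cumLLR ν μ M k y :=
    Finset.sum_congr rfl fun i hi => Finset.sum_congr rfl fun j _ => by rw [hxy j i hi]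
  simp only [sumSPRT, this]

theorem cumLLR_history {ν μ : Measure ℝ} (k : ℕ) (ω : Path s) :
    cumLLR ν μ M k (history k ω) = ∑ j ∈ Finset.range (k + 1), ∑ i ∈ M, llr μ ν (ω j i) := by
  rw [cumLLR, Finset.sum_comm, Finset.sum_range]
  rfl

theorem isThresholdTree_sumSPRT {ν μ : Measure ℝ} (p : Thresholds) :
    IsThresholdTree M (llr μ ν) p.1.1 p.1.2 (sumSPRT ν μ M p).running
      ((sumSPRT ν μ M p).stopsAt Decision.one) ((sumSPRT ν μ M p).stopsAt Decision.zero) := by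
  have hrun : ∀ k, ∀ ω ∈ (sumSPRT ν μ M p).running k,
      -p.1.1 ≤ ∑ j ∈ Finset.range k, ∑ i ∈ M, llr μ ν (ω j i) ∧
        ∑ j ∈ Finset.range k, ∑ i ∈ M, llr μ ν (ω j i) ≤ p.1.2 := by
    intro k ω hω
    cases k with
    -- Before any observation the empty sum `0` lies between the thresholds because both are
    -- positive.
    | zero => simpa using ⟨p.2.1.le, p.2.2.le⟩
    | succ k =>
      have := hω k k.lt_succ_self
      simp only [sumSPRT, cumLLR_history] at this
      split_ifs at this with h1 h2
      exact ⟨(not_le.1 h1).le, (not_le.1 h2).le⟩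
  refine ⟨Strategy.isTestTree (sumSPRT_basedOn p), fun k ω hω => (hrun k ω hω).2,
    fun k ω hω => (hrun k ω hω).1, fun k ω hω => ?_, fun k ω hω => ?_⟩
  · have := hω.1
    simp only [sumSPRT, cumLLR_history] at this
    split_ifs at this with h1 h2
    exact h2
  · have := hω.1
    simp only [sumSPRT, cumLLR_history] at this
    split_ifs at this with h1 h2
    exact h1

/-- Under `ν` the walk drifts to `-a`, and `a ≤ log (1/β)`; under `μ` it drifts to `b`, and `b ≤ log
(1/α)`. -/
theorem delay_sumSPRT_le (hμν : μ ≪ ν) (hνμ : ν ≪ μ)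
    (hint0 : Integrable (llr μ ν) ν) (hint1 : Integrable (llr μ ν) μ) {c : ℝ} (hc : 0 ≤ c)
    (h0 : 0 < truncatedMean M (fun x => -llr μ ν x) ν c) (h1 : 0 < truncatedMean M (llr μ ν) μ c)
    {p : Thresholds} (hα : 0 < (sumSPRT ν μ M p).errorI ν)
    (hβ : 0 < (sumSPRT ν μ M p).errorII μ) :
    (sumSPRT ν μ M p).delay ν μ ≤ ENNReal.ofReal (max
      ((Real.log (1 / (sumSPRT ν μ M p).errorII μ) + c)
        / truncatedMean M (fun x => -llr μ ν x) ν c)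
      ((Real.log (1 / (sumSPRT ν μ M p).errorI ν) + c) / truncatedMean M (llr μ ν) μ c)) := by
  have t := isThresholdTree_sumSPRT (ν := ν) (μ := μ) (M := M) p
  rw [Strategy.delay_eq (sumSPRT_basedOn p), ENNReal.ofReal_max]
  rw [Strategy.errorI_eq] at hα ⊢
  rw [Strategy.errorII_eq] at hβ ⊢
  refine max_le_max ?_ ?_
  · refine (t.swap.tsum_le (measurable_llr μ ν).neg hint0.neg hc h0).trans
      (ENNReal.ofReal_le_ofReal (div_le_div_of_nonneg_right (add_le_add_left ?_ c) h0.le))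
    exact t.swap.le_log (measurable_llr μ ν).neg
      (by simpa using eq_withDensity_exp_llr hμν hνμ) hβ
  · refine (t.tsum_le (measurable_llr μ ν) hint1 hc h1).trans
      (ENNReal.ofReal_le_ofReal (div_le_div_of_nonneg_right (add_le_add_left ?_ c) h1.le))
    exact t.le_log (measurable_llr μ ν) (eq_withDensity_exp_neg_llr hμν hνμ) hα

theorem eventually_lt_efficiency_sumSPRT (hM : M.Nonempty) (hμν : μ ≪ ν) (hνμ : ν ≪ μ)
    (hint0 : Integrable (llr μ ν) ν) (hint1 : Integrable (llr μ ν) μ)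
    (hI0 : 0 < klZero ν μ) (hI1 : 0 < klOne ν μ) {y : ℝ≥0∞}
    (hy : y < ENNReal.ofReal (M.card * min (klZero ν μ) (klOne ν μ))) :
    ∀ᶠ p in balancedErrors ν μ (sumSPRT ν μ M), y < (sumSPRT ν μ M p).efficiency ν μ := by
  set l := balancedErrors ν μ (sumSPRT ν μ M)
  set u : Thresholds → ℝ := fun p => Real.log (1 / (sumSPRT ν μ M p).errorI ν)
  set v : Thresholds → ℝ := fun p => Real.log (1 / (sumSPRT ν μ M p).errorII μ)
  have hα : Tendsto (fun p => (sumSPRT ν μ M p).errorI ν) l (𝓝[>] 0) := tendsto_errorI_balanced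
  have hβ : Tendsto (fun p => (sumSPRT ν μ M p).errorII μ) l (𝓝[>] 0) := tendsto_errorII_balanced
  have hu : Tendsto u l atTop := tendsto_log_one_div_atTop hα
  have hv : Tendsto v l atTop := tendsto_log_one_div_atTop hβ
  have hvu : Tendsto (fun p => v p / u p) l (𝓝 1) := tendsto_log_ratio_balanced
  rw [klZero, ← integral_neg] at hI0 hy
  have hmean0 := tendsto_truncatedMean (M := M) (measurable_llr μ ν).neg hint0.neg
  have hmean1 := tendsto_truncatedMean (M := M) (measurable_llr μ ν) hint1
  have hmean := ENNReal.tendsto_ofReal (hmean0.min hmean1)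
  rw [mul_min_of_nonneg _ _ (Nat.cast_nonneg _)] at hy
  -- One truncation level serves both hypotheses and keeps the smaller truncated drift above `y`; it
  -- stays fixed while the errors vanish.
  obtain ⟨c, hcy, hc0, hc1⟩ := ((hmean.eventually_const_lt hy).and
    ((eventually_truncatedMean_pos hM (measurable_llr μ ν).neg hint0.neg hI0).and
    (eventually_truncatedMean_pos hM (measurable_llr μ ν) hint1 hI1))).exists
  set m0 := truncatedMean M (fun x => -llr μ ν x) ν c
  set m1 := truncatedMean M (llr μ ν) μ c
  -- This is `u` over the delay bound, with numerator and denominator divided by `u`.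
  have hlim : Tendsto (fun p => ENNReal.ofReal (min (m0 * (v p / u p + c * (u p)⁻¹)⁻¹)
      (m1 * (1 + c * (u p)⁻¹)⁻¹))) l (𝓝 (ENNReal.ofReal (min m0 m1))) := by
    have hcu : Tendsto (fun p => c * (u p)⁻¹) l (𝓝 0) := by
      simpa using hu.inv_tendsto_atTop.const_mul (c : ℝ)
    have a0 := ((hvu.add hcu).inv₀ (by norm_num)).const_mul m0
    have a1 := ((hcu.const_add 1).inv₀ (by norm_num)).const_mul m1
    rw [add_zero, inv_one, mul_one] at a0 a1
    exact ENNReal.tendsto_ofReal (a0.min a1)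
  filter_upwards [hlim.eventually_const_lt hcy, hu.eventually_gt_atTop 0, hv.eventually_gt_atTop 0,
    hα self_mem_nhdsWithin, hβ self_mem_nhdsWithin] with p hp hup hvp hαp hβp
  refine hp.trans_le ?_
  have hD := delay_sumSPRT_le hμν hνμ hint0 hint1 c.cast_nonneg hc0 hc1 hαp hβp
  change _ ≤ ENNReal.ofReal (max ((v p + c) / m0) ((u p + c) / m1)) at hD
  have hc : (0 : ℝ) ≤ c := c.cast_nonneg
  replace hc0 : 0 < m0 := hc0
  have hmin : 0 ≤ min (m0 * (v p / u p + c * (u p)⁻¹)⁻¹) (m1 * (1 + c * (u p)⁻¹)⁻¹) := by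
    positivity
  refine le_trans ?_ (ENNReal.div_le_div_left hD _)
  have hK : 0 < max ((v p + c) / m0) ((u p + c) / m1) := lt_max_of_lt_left (by positivity)
  rw [← ENNReal.ofReal_div_of_pos hK]
  refine ENNReal.ofReal_le_ofReal ?_
  change _ ≤ u p / _
  rw [le_div_iff₀ hK, mul_max_of_nonneg _ _ hmin]
  refine max_le ?_ ?_
  · refine (mul_le_mul_of_nonneg_right (min_le_left _ _) (by positivity)).trans (le_of_eq ?_)
    field_simp
  · refine (mul_le_mul_of_nonneg_right (min_le_right _ _) (by positivity)).trans (le_of_eq ?_)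
    field_simp

theorem tendsto_efficiency_sumSPRT (hM : M.Nonempty) (hμν : μ ≪ ν) (hνμ : ν ≪ μ)
    (hint0 : Integrable (llr μ ν) ν) (hint1 : Integrable (llr μ ν) μ)
    (hI0 : 0 < klZero ν μ) (hI1 : 0 < klOne ν μ) :
    Tendsto (fun p => (sumSPRT ν μ M p).efficiency ν μ) (balancedErrors ν μ (sumSPRT ν μ M))
      (𝓝 (ENNReal.ofReal (M.card * min (klZero ν μ) (klOne ν μ)))) := by
  obtain ⟨h, hle, hlim⟩ := exists_efficiency_le_tendsto
    (sumSPRT_basedOn (ν := ν) (μ := μ) (M := M)) hμν hνμ hint0 hint1 hI0 hI1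
  rw [tendsto_order]
  refine ⟨fun y hy => eventually_lt_efficiency_sumSPRT hM hμν hνμ hint0 hint1 hI0 hI1 hy,
    fun y hy => ?_⟩
  filter_upwards [hle, hlim.eventually_lt_const hy] with p h1 h2
  exact h1.trans_lt h2

/-- Equal thresholds `n + 1` realise the regime: both logarithmic errors are asymptotic to `n + 1`,
so their quotient tends to `1` even if the errors are never equal. -/
theorem balancedErrors_sumSPRT_neBot (hM : M.Nonempty) (hμν : μ ≪ ν) (hνμ : ν ≪ μ)
    (hint0 : Integrable (llr μ ν) ν) (hint1 : Integrable (llr μ ν) μ)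
    (hI0 : 0 < klZero ν μ) (hI1 : 0 < klOne ν μ) :
    (balancedErrors ν μ (sumSPRT ν μ M)).NeBot := by
  let p : ℕ → Thresholds := fun n => ⟨(n + 1, n + 1), by positivity, by positivity⟩
  have t : ∀ n : ℕ, IsThresholdTree M (llr μ ν) (n + 1) (n + 1) _ _ _ :=
    fun n => isThresholdTree_sumSPRT (ν := ν) (μ := μ) (M := M) (p n)
  have hd0 := eq_withDensity_exp_neg_llr hμν hνμ
  have hd1 : μ = ν.withDensity fun x => ENNReal.ofReal (Real.exp (-(-llr μ ν x))) := by
    simpa using eq_withDensity_exp_llr hμν hνμ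
  rw [klZero, ← integral_neg] at hI0
  have hα : ∀ n : ℕ, (sumSPRT ν μ M (p n)).errorI ν ≤ Real.exp (-(n + 1)) := fun n => by
    rw [Strategy.errorI_eq]
    exact (t n).real_le_exp_neg (measurable_llr μ ν) hd0
  have hβ : ∀ n : ℕ, (sumSPRT ν μ M (p n)).errorII μ ≤ Real.exp (-(n + 1)) := fun n => by
    rw [Strategy.errorII_eq]
    exact (t n).swap.real_le_exp_neg (measurable_llr μ ν).neg hd1
  have hlt : ∀ n : ℕ, Real.exp (-((n : ℝ) + 1)) < 1 := fun n => by
    rw [Real.exp_lt_one_iff]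
    linarith [n.cast_nonneg (α := ℝ)]
  have hα0 : ∀ n : ℕ, 0 < (sumSPRT ν μ M (p n)).errorI ν := fun n => by
    rw [Strategy.errorI_eq]
    refine (t n).real_pos_of_pos hM (measurable_llr μ ν) hint1 hI1 hd0 ?_
    rw [← Strategy.errorII_eq]
    exact (hβ n).trans_lt (hlt n)
  have hβ0 : ∀ n : ℕ, 0 < (sumSPRT ν μ M (p n)).errorII μ := fun n => by
    rw [Strategy.errorII_eq]
    refine (t n).swap.real_pos_of_pos hM (measurable_llr μ ν).neg hint0.neg hI0 hd1 ?_
    rw [← Strategy.errorI_eq]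
    exact (hα n).trans_lt (hlt n)
  have hexp : Tendsto (fun n : ℕ => Real.exp (-((n : ℝ) + 1))) atTop (𝓝 0) :=
    Real.tendsto_exp_neg_atTop_nhds_zero.comp
      (tendsto_atTop_add_const_right _ _ tendsto_natCast_atTop_atTop)
  have hu := tendsto_log_div hM (measurable_llr μ ν) hint1 hI1 hd0 t
    fun n => by rw [← Strategy.errorII_eq]; exact hβ n
  have hv := tendsto_log_div hM (measurable_llr μ ν).neg hint0.neg hI0 hd1 (fun n => (t n).swap)
    fun n => by rw [← Strategy.errorI_eq]; exact hα n
  simp_rw [← Strategy.errorI_eq] at hu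
  simp_rw [← Strategy.errorII_eq] at hv
  have hp : Tendsto p atTop (balancedErrors ν μ (sumSPRT ν μ M)) := by
    refine tendsto_inf.2 ⟨tendsto_inf.2 ⟨?_, ?_⟩, ?_⟩ <;> rw [tendsto_comap_iff]
    · exact tendsto_nhdsWithin_iff.2 ⟨squeeze_zero (fun n => (hα0 n).le) hα hexp,
        Eventually.of_forall hα0⟩
    · exact tendsto_nhdsWithin_iff.2 ⟨squeeze_zero (fun n => (hβ0 n).le) hβ hexp,
        Eventually.of_forall hβ0⟩
    · have h := hu.div hv one_ne_zero
      rw [div_one] at h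
      refine h.congr fun n => ?_
      have hn : (n : ℝ) + 1 ≠ 0 := by positivity
      simp only [Pi.div_apply, Function.comp_apply, one_div, Real.log_inv]
      rw [div_div_div_cancel_right₀ hn, neg_div_neg_eq]
  exact hp.neBot

end SumSPRT

end SeqDetect

end

theorem lemma1 (s : ℕ) (ν μ : Measure ℝ) [IsProbabilityMeasure ν] [IsProbabilityMeasure μ]
    (hμν : μ ≪ ν) (hνμ : ν ≪ μ)
    (hint0 : Integrable (llr μ ν) ν) (hint1 : Integrable (llr μ ν) μ)
    (hI0 : 0 < SeqDetect.klZero ν μ) (hI1 : 0 < SeqDetect.klOne ν μ)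
    (M : Finset (Fin s)) (C : ℝ≥0∞)
    (hC : C = ENNReal.ofReal (M.card * min (SeqDetect.klZero ν μ) (SeqDetect.klOne ν μ))) :
    -- no family of tests based on the sensors in `M` has performance above `|M| * min I₀ I₁`
    (∀ (ι : Type*) (f : ι → SeqDetect.Strategy s), (∀ i, (f i).BasedOn M) →
      limsup (fun i => (f i).efficiency ν μ) (SeqDetect.equalErrors ν μ f) ≤ C ∧
      limsup (fun i => (f i).efficiency ν μ) (SeqDetect.balancedErrors ν μ f) ≤ C) ∧
    -- the sum-SPRT is based on `M` and has performance exactly `|M| * min I₀ I₁`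
    (∀ p, (SeqDetect.sumSPRT ν μ M p).BasedOn M) ∧
    (M.Nonempty →
      Tendsto (fun p => (SeqDetect.sumSPRT ν μ M p).efficiency ν μ)
        (SeqDetect.equalErrors ν μ (SeqDetect.sumSPRT ν μ M)) (𝓝 C) ∧
      (SeqDetect.balancedErrors ν μ (SeqDetect.sumSPRT ν μ M)).NeBot ∧
      Tendsto (fun p => (SeqDetect.sumSPRT ν μ M p).efficiency ν μ)
        (SeqDetect.balancedErrors ν μ (SeqDetect.sumSPRT ν μ M)) (𝓝 C)) := by
  subst hC
  have hle := SeqDetect.equalErrors_le_balancedErrors (ν := ν) (μ := μ)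
    (f := SeqDetect.sumSPRT ν μ M)
  refine ⟨fun ι f hf => ?_, SeqDetect.sumSPRT_basedOn, fun hM => ?_⟩
  · obtain ⟨h, hev, hlim⟩ :=
      SeqDetect.exists_efficiency_le_tendsto hf hμν hνμ hint0 hint1 hI0 hI1
    have hle' := SeqDetect.equalErrors_le_balancedErrors (ν := ν) (μ := μ) (f := f)
    exact ⟨SeqDetect.limsup_le_of_eventually_le_tendsto (hev.filter_mono hle') (hlim.mono_left hle'),
      SeqDetect.limsup_le_of_eventually_le_tendsto hev hlim⟩
  · have hlim := SeqDetect.tendsto_efficiency_sumSPRT hM hμν hνμ hint0 hint1 hI0 hI1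
    exact ⟨hlim.mono_left hle,
      SeqDetect.balancedErrors_sumSPRT_neBot hM hμν hνμ hint0 hint1 hI0 hI1, hlim⟩
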